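/- Let $\mathcal H$ be a complex separable Hilbert space (inner product linear in the second variable), $I\subseteq\mathbb R$ an interval with more than one point, and $\{\rho_\theta\}_{\theta\in I}$ a family of quantum states (positive trace class operators of trace one) with $\ker\rho_\theta=\{0\}$ for all $\theta\in I$, which is weak*-differentiable: for every $\theta\in I$ there is a trace class operator $\rho'_\theta$ with $\frac{d}{d\theta}\mathrm{Tr}(\rho_\theta K)=\mathrm{Tr}(\rho'_\theta K)$ for all compact operators $K$ (one-sided derivative at an end point of $I$). Fix $\theta\in I$, write $\rho=\rho_\theta$, $\rho'=\rho'_\theta$, and consider 1. $F_{H}[u,v]=\int_0^\infty\big\langle(\rho+x)^{-1}u,\ (\rho'+\|\rho'\|+1)(\rho+x)^{-1}v\big\rangle\,dx$ on $D(\rho^{-1/2})$; 2. $F_{\widetilde H}[u,v]=\int_0^\infty\big\langle e^{-s/(2\rho)}u,\ (\rho'+\|\rho'\|+1)e^{-s/(2\rho)}v\big\rangle\,ds$ on $D(\rho^{-1})$; 3. $F_{\widehat H}[u,v]=\big\langle\rho^{-1/2}u,\ (\rho'+\|\rho'\|+1)\rho^{-1/2}v\big\rangle$ on $D(\rho^{-1/2})$;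 4. $F_{\widetilde{\widetilde H}}[u,v]=\int_0^\infty\big\langle e^{-s\rho/2}u,\ (\rho'+\|\rho'\|+1)e^{-s\rho/2}v\big\rangle\,ds$ on $D(\rho^{-1/2})$. Then all the integrals converge absolutely, and each of the four is a densely defined symmetric sesquilinear form that is bounded below. The forms (1), (3), (4) are closed. For each of them, with form domain $D$, there is exactly one self-adjoint operator $K$ with $D(K)\subseteq D$ and $F[u,v]=\langle u,Kv\rangle$ for all $u\in D$, $v\in D(K)$. The form (2) is closable: its integral converges absolutely for all $u,v\in\mathcal H$, and the resulting everywhere defined form is a closed, semibounded symmetric form which is the closure of $F_{\widetilde H}$. There is exactly one self-adjoint operator $K$ that represents this closure in the sense above. Moreover, there is exactly one self-adjoint operator $K$ with $D(\rho^{-1})\subseteq D(K)$ and $F_{\widetilde H}[u,v]=\langle u,Kv\rangle$ for all $u,v\in D(\rho^{-1})$. In all four cases the operator $K-(\|\rho'\|+1)$ with domain $D(K)$ is self-adjoint. These four operators are the logarithmic derivatives $H$, $\widetilde H$, $\widehat H$ and $\widetilde{\widetilde H}$ (SLD) in infinite dimension. -/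

import Mathlib

open MeasureTheory Filter Topology
open scoped InnerProductSpace

noncomputable section

namespace QuantumLD

variable {H : Type*} [NormedAddCommGroup H] [InnerProductSpace ℂ H] [CompleteSpace H]

/-! ### Trace class operators, states, weak-star derivatives -/

/-- Index set of a fixed Hilbert basis of `H`. -/
def basisIndex (H : Type*) [NormedAddCommGroup H] [InnerProductSpace ℂ H] [CompleteSpace H] :
    Set H :=
  (exists_hilbertBasis ℂ H).choose

/-- A fixed Hilbert basis of `H`; traces do not depend on which one is used. -/
def basis (H : Type*) [NormedAddCommGroup H] [InnerProductSpace ℂ H] [CompleteSpace H] :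
    HilbertBasis (basisIndex H) ℂ H :=
  (exists_hilbertBasis ℂ H).choose_spec.choose

/-- `T` is trace class: `∑ᵢ ⟨bᵢ, |T| bᵢ⟩ < ∞`, where `|T| = (T* T)^{1/2}`. -/
def IsTraceClass (T : H →L[ℂ] H) : Prop :=
  Summable fun i => RCLike.re ⟪basis H i, CFC.abs T (basis H i)⟫_ℂ

/-- The trace `∑ᵢ ⟨bᵢ, T bᵢ⟩` of a trace class operator. -/
def trace (T : H →L[ℂ] H) : ℂ :=
  ∑' i, ⟪basis H i, T (basis H i)⟫_ℂ

/-- A quantum state (density operator): positive, trace class, of trace one. -/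
structure IsState (ρ : H →L[ℂ] H) : Prop where
  isPositive : ρ.IsPositive
  isTraceClass : IsTraceClass ρ
  trace_eq_one : trace ρ = 1

/-- The trace class operator `ρ'` is the derivative at `θ`, within `I`, of the curve `ρ` in the
weak-star topology of the trace class operators, seen as the dual of the compact operators
through `⟨T, K⟩ = Tr (T K)`. -/
def HasWeakStarDerivWithinAt (ρ : ℝ → H →L[ℂ] H) (ρ' : H →L[ℂ] H) (I : Set ℝ) (θ : ℝ) : Prop :=
  IsTraceClass ρ' ∧ ∀ K : H →L[ℂ] H, IsCompactOperator K →
    HasDerivWithinAt (fun t => trace (ρ t * K)) (trace (ρ' * K)) I θ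

/-! ### Functions of an injective positive operator -/

/-- The (in general unbounded) inverse of an injective bounded operator; its domain is the
range. -/
def unboundedInv (T : H →L[ℂ] H) : H →ₗ.[ℂ] H :=
  ((T : H →ₗ[ℂ] H).toPMap ⊤).inverse

/-- `ρ⁻¹` for an injective positive operator `ρ`. -/
def rhoInv (ρ : H →L[ℂ] H) : H →ₗ.[ℂ] H := unboundedInv ρ

/-- `ρ^{-1/2}` for an injective positive operator `ρ`: the inverse of the positive square root. -/
def rhoInvSqrt (ρ : H →L[ℂ] H) : H →ₗ.[ℂ] H := unboundedInv (CFC.sqrt ρ)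

/-- The resolvent operator `(ρ + x)⁻¹` for `x > 0`. -/
def resolv (ρ : H →L[ℂ] H) (x : ℝ) : H →L[ℂ] H :=
  Ring.inverse (ρ + (x : ℂ) • (1 : H →L[ℂ] H))

/-- The semigroup `exp (-s ρ / 2)`. -/
def expSemigroup (ρ : H →L[ℂ] H) (s : ℝ) : H →L[ℂ] H :=
  NormedSpace.exp (-((s / 2 : ℝ) : ℂ) • ρ)

/-- The semigroup `exp (-s / (2 ρ))`, for `s > 0` and `ρ` positive and injective, by functional
calculus: the function `l ↦ exp (-s / (2 l))` on `(0, ∞)`, continued by its limit `0` at `l = 0`,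
is continuous on `[0, ∞)`. -/
def expInvSemigroup (ρ : H →L[ℂ] H) (s : ℝ) : H →L[ℂ] H :=
  cfc (fun l : ℝ => if l = 0 then 0 else Real.exp (-s / (2 * l))) ρ

/-- The operator `ρ' + ‖ρ'‖ + 1`. -/
def shifted (ρ' : H →L[ℂ] H) : H →L[ℂ] H :=
  ρ' + ((‖ρ'‖ + 1 : ℝ) : ℂ) • (1 : H →L[ℂ] H)

/-! ### Sesquilinear forms with a domain -/

/-- `F` is a densely defined symmetric sesquilinear form (conjugate linear in the first argument)
on the subspace `D`, bounded below. -/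
structure IsSemiboundedForm (D : Submodule ℂ H) (F : D → D → ℂ) : Prop where
  dense : Dense (D : Set H)
  sesquilinear : ∃ B : D →ₗ⋆[ℂ] D →ₗ[ℂ] ℂ, ∀ u v, F u v = B u v
  symm : ∀ u v, F u v = starRingEnd ℂ (F v u)
  bounded_below : ∃ c : ℝ, ∀ u : D, c * ‖(u : H)‖ ^ 2 ≤ (F u u).re

/-- `F` is closed: if `uₙ ∈ D`, `uₙ → u` in `H` and `F[uₙ - uₘ, uₙ - uₘ] → 0`, then
`u ∈ D` and `F[uₙ - u, uₙ - u] → 0`. -/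
def IsClosedForm (D : Submodule ℂ H) (F : D → D → ℂ) : Prop :=
  ∀ (u : ℕ → D) (w : H), Tendsto (fun n => (u n : H)) atTop (𝓝 w) →
    Tendsto (fun p : ℕ × ℕ => F (u p.1 - u p.2) (u p.1 - u p.2)) atTop (𝓝 0) →
    ∃ hw : w ∈ D, Tendsto (fun n => F (u n - ⟨w, hw⟩) (u n - ⟨w, hw⟩)) atTop (𝓝 0)

/-- `F'`, with domain `D'`, is the closure of the form `F` with domain `D`: it is a closed
semibounded extension of `F` of which `D` is a core. -/
structure IsFormClosure (D : Submodule ℂ H) (F : D → D → ℂ)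
    (D' : Submodule ℂ H) (F' : D' → D' → ℂ) : Prop where
  semibounded : IsSemiboundedForm D' F'
  closed : IsClosedForm D' F'
  le : D ≤ D'
  extends_form : ∀ u v : D, F' (Submodule.inclusion le u) (Submodule.inclusion le v) = F u v
  core : ∀ w : D', ∃ u : ℕ → D, Tendsto (fun n => (u n : H)) atTop (𝓝 (w : H)) ∧
    Tendsto (fun n => F' (Submodule.inclusion le (u n) - w) (Submodule.inclusion le (u n) - w))
      atTop (𝓝 0)

/-- The self-adjoint operator `K` represents the form `F` with domain `D`: its domain is contained
in `D`, and `F[u, v] = ⟨u, K v⟩` for `u ∈ D` and `v` in the domain of `K`. -/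
structure Represents (D : Submodule ℂ H) (F : D → D → ℂ) (K : H →ₗ.[ℂ] H) : Prop where
  selfAdjoint : IsSelfAdjoint K
  domain_le : K.domain ≤ D
  apply_eq : ∀ (u : D) (v : K.domain), F u (Submodule.inclusion domain_le v) = ⟪(u : H), K v⟫_ℂ

/-- The operator `K - (‖ρ'‖ + 1)`, with the domain of `K`. -/
def unshift (ρ' : H →L[ℂ] H) (K : H →ₗ.[ℂ] H) : H →ₗ.[ℂ] H :=
  (-((‖ρ'‖ + 1 : ℝ) : ℂ)) • (LinearMap.id : H →ₗ[ℂ] H) +ᵥ K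

/-! ### The four forms -/

/-- The integrand of the form with the resolvent of `ρ`. -/
def integrandBvN (ρ ρ' : H →L[ℂ] H) (u v : H) (x : ℝ) : ℂ :=
  ⟪resolv ρ x u, shifted ρ' (resolv ρ x v)⟫_ℂ

/-- The integrand of the form with the semigroup `exp (-s / (2 ρ))`. -/
def integrandTilde (ρ ρ' : H →L[ℂ] H) (u v : H) (s : ℝ) : ℂ :=
  ⟪expInvSemigroup ρ s u, shifted ρ' (expInvSemigroup ρ s v)⟫_ℂ

/-- The integrand of the form with the semigroup `exp (-s ρ / 2)`. -/
def integrandSLD (ρ ρ' : H →L[ℂ] H) (u v : H) (s : ℝ) : ℂ :=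
  ⟪expSemigroup ρ s u, shifted ρ' (expSemigroup ρ s v)⟫_ℂ

/-- `∫₀^∞ ⟨(ρ + x)⁻¹ u, (ρ' + ‖ρ'‖ + 1) (ρ + x)⁻¹ v⟩ dx` for `u`, `v` in the subspace `D`. -/
def formBvN (ρ ρ' : H →L[ℂ] H) (D : Submodule ℂ H) (u v : D) : ℂ :=
  ∫ x in Set.Ioi (0 : ℝ), integrandBvN ρ ρ' u v x

/-- `∫₀^∞ ⟨exp (-s / (2 ρ)) u, (ρ' + ‖ρ'‖ + 1) exp (-s / (2 ρ)) v⟩ ds` for `u`, `v` in the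
subspace `D`. -/
def formTilde (ρ ρ' : H →L[ℂ] H) (D : Submodule ℂ H) (u v : D) : ℂ :=
  ∫ s in Set.Ioi (0 : ℝ), integrandTilde ρ ρ' u v s

/-- `⟨ρ^{-1/2} u, (ρ' + ‖ρ'‖ + 1) ρ^{-1/2} v⟩` for `u`, `v` in the domain of `ρ^{-1/2}`. -/
def formHat (ρ ρ' : H →L[ℂ] H) (u v : (rhoInvSqrt ρ).domain) : ℂ :=
  ⟪rhoInvSqrt ρ u, shifted ρ' (rhoInvSqrt ρ v)⟫_ℂ

/-- `∫₀^∞ ⟨exp (-s ρ / 2) u, (ρ' + ‖ρ'‖ + 1) exp (-s ρ / 2) v⟩ ds` for `u`, `v` in the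
subspace `D`. -/
def formSLD (ρ ρ' : H →L[ℂ] H) (D : Submodule ℂ H) (u v : D) : ℂ :=
  ∫ s in Set.Ioi (0 : ℝ), integrandSLD ρ ρ' u v s

/-- A closed form `F` on `D` defines a unique self-adjoint operator `K`, and the logarithmic
derivative `L = K - (‖ρ'‖ + 1)` is self-adjoint. -/
def DefinesLD (ρ' : H →L[ℂ] H) (D : Submodule ℂ H) (F : D → D → ℂ) : Prop :=
  ∃ K : H →ₗ.[ℂ] H, Represents D F K ∧ (∀ K', Represents D F K' → K' = K) ∧
    IsSelfAdjoint (unshift ρ' K)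

end QuantumLD

end

namespace QuantumLD

variable {H : Type*} [NormedAddCommGroup H] [InnerProductSpace ℂ H] [CompleteSpace H]

/-! ### Self-adjoint partially defined operators -/

/-! Put J = ρ^{1/2} and S = ρ' + ‖ρ'‖ + 1. Testing the weak* derivative on rank one operators gives
ρ'* = ρ', so S is bounded, self-adjoint and S ≥ 1.

Forms (1), (3), (4) have the shape ⟨J⁻¹u, A J⁻¹v⟩ on D(J⁻¹) = ran J with A bounded and A ≥ 1. For
(3), A = S. For (1) and (4), A is the average of (T_x J)* S (T_x J), and the scalar identities ∫
l/(l+x)² dx = 1 and ∫ l e^{-sl} ds = 1 for l > 0 become ∫ ‖T_x J w‖² dx = ‖w‖²; hence A is bounded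
and A ≥ 1 (`exists_average`). These operator identities come from the fundamental theorem of
calculus for ⟨w, x(ρ+x)⁻¹w⟩ and -⟨w, e^{-sρ}w⟩; injectivity of ρ makes the limits at x = 0 and s = ∞
vanish.

For this shape no general representation theorem is needed: A ≥ 1 gives closedness, and the operator
is K = (J A⁻¹ J)⁻¹, the inverse of an injective bounded self-adjoint operator. Any other
representing operator is contained in K, hence equal to it, as self-adjoint operators are maximal
(`definesLD_of_eq_inner_unboundedInv`).

Form (2) is bounded: the spectrum of ρ is bounded above, so e^{-s/(2ρ)} decays exponentially in s.
Closure and operator then come from one bounded operator and the density of ran ρ. -/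

theorem isSelfAdjoint_of_symmetric_of_maximal {K : H →ₗ.[ℂ] H} (hd : Dense (K.domain : Set H))
    (hs : ∀ x y : K.domain, ⟪K x, (y : H)⟫_ℂ = ⟪(x : H), K y⟫_ℂ)
    (hm : ∀ y z : H, (∀ x : K.domain, ⟪z, (x : H)⟫_ℂ = ⟪y, K x⟫_ℂ) → y ∈ K.domain) :
    IsSelfAdjoint K := by
  have hle : K ≤ K.adjoint := LinearPMap.IsFormalAdjoint.le_adjoint hd hs
  refine (LinearPMap.eq_of_le_of_domain_eq hle (le_antisymm hle.1 fun y hy => ?_)).symm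
  exact hm y (K.adjoint ⟨y, hy⟩) fun x => LinearPMap.adjoint_isFormalAdjoint hd ⟨y, hy⟩ x

theorem inner_apply_of_isSelfAdjoint {K : H →ₗ.[ℂ] H} (hK : IsSelfAdjoint K) (x y : K.domain) :
    ⟪K x, (y : H)⟫_ℂ = ⟪(x : H), K y⟫_ℂ := by
  have h := LinearPMap.adjoint_isFormalAdjoint hK.dense_domain
  rw [LinearPMap.isSelfAdjoint_def.mp hK] at h
  exact h x y

theorem mem_domain_of_isSelfAdjoint {K : H →ₗ.[ℂ] H} (hK : IsSelfAdjoint K) {y z : H}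
    (h : ∀ x : K.domain, ⟪z, (x : H)⟫_ℂ = ⟪y, K x⟫_ℂ) : y ∈ K.domain := by
  have := LinearPMap.mem_adjoint_domain_of_exists (T := K) y ⟨z, h⟩
  rwa [LinearPMap.isSelfAdjoint_def.mp hK] at this

/-- A self-adjoint operator has no proper self-adjoint extension. -/
theorem eq_of_le_of_isSelfAdjoint {K L : H →ₗ.[ℂ] H} (hK : IsSelfAdjoint K)
    (hL : IsSelfAdjoint L) (hle : K ≤ L) : K = L := by
  refine LinearPMap.eq_of_le_of_domain_eq hle (le_antisymm hle.1 fun y hy => ?_)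
  refine mem_domain_of_isSelfAdjoint hK (z := L ⟨y, hy⟩) fun x => ?_
  rw [hle.2 (x := x) (y := ⟨x, hle.1 x.2⟩) rfl]
  exact inner_apply_of_isSelfAdjoint hL ⟨y, hy⟩ ⟨x, hle.1 x.2⟩

theorem isSelfAdjoint_real_smul_id_vadd {K : H →ₗ.[ℂ] H} (hK : IsSelfAdjoint K) (r : ℝ) :
    IsSelfAdjoint ((r : ℂ) • (LinearMap.id : H →ₗ[ℂ] H) +ᵥ K) := by
  refine isSelfAdjoint_of_symmetric_of_maximal hK.dense_domain (fun x y => ?_) fun y z h => ?_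
  · have := inner_apply_of_isSelfAdjoint hK x y
    change ⟪(r : ℂ) • (x : H) + K x, (y : H)⟫_ℂ = ⟪(x : H), (r : ℂ) • (y : H) + K y⟫_ℂ
    simp [this]
  · refine mem_domain_of_isSelfAdjoint hK (z := z - (r : ℂ) • y) fun x => ?_
    have := h x
    change _ = ⟪y, (r : ℂ) • (x : H) + K x⟫_ℂ at this
    simp [this]

theorem isSelfAdjoint_unshift (ρ' : H →L[ℂ] H) {K : H →ₗ.[ℂ] H} (hK : IsSelfAdjoint K) :
    IsSelfAdjoint (unshift ρ' K) := by
  have := isSelfAdjoint_real_smul_id_vadd hK (-(‖ρ'‖ + 1))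
  rwa [Complex.ofReal_neg] at this

/-! ### Inverses of injective self-adjoint operators -/

theorem mem_unboundedInv_domain {T : H →L[ℂ] H} {y : H} :
    y ∈ (unboundedInv T).domain ↔ ∃ x, T x = y := by
  rw [unboundedInv, LinearPMap.inverse_domain]
  simp [LinearMap.mem_range, LinearMap.toPMap]

theorem unboundedInv_apply_eq {T : H →L[ℂ] H} (hT : LinearMap.ker (T : H →ₗ[ℂ] H) = ⊥)
    {y : (unboundedInv T).domain} {x : H} (h : T x = y) : unboundedInv T y = x := by
  refine LinearPMap.inverse_apply_eq (f := (T : H →ₗ[ℂ] H).toPMap ⊤) ?_ (x := ⟨x, trivial⟩) h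
  rw [LinearMap.ker_eq_bot'] at hT ⊢
  exact fun m hm => Subtype.ext (hT m hm)

theorem apply_unboundedInv {T : H →L[ℂ] H} (hT : LinearMap.ker (T : H →ₗ[ℂ] H) = ⊥)
    (y : (unboundedInv T).domain) : T (unboundedInv T y) = y := by
  obtain ⟨x, hx⟩ := mem_unboundedInv_domain.mp y.2
  rw [unboundedInv_apply_eq hT hx, hx]

theorem inner_map_eq_of_isSelfAdjoint {T : H →L[ℂ] H} (hT : IsSelfAdjoint T) (x y : H) :
    ⟪T x, y⟫_ℂ = ⟪x, T y⟫_ℂ :=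
  ContinuousLinearMap.isSelfAdjoint_iff_isSymmetric.mp hT x y

theorem dense_unboundedInv_domain {T : H →L[ℂ] H} (hT : IsSelfAdjoint T)
    (hker : LinearMap.ker (T : H →ₗ[ℂ] H) = ⊥) :
    Dense ((unboundedInv T).domain : Set H) := by
  rw [Submodule.dense_iff_topologicalClosure_eq_top, Submodule.topologicalClosure_eq_top_iff,
    Submodule.eq_bot_iff]
  intro x hx
  have hx' : ∀ y, ⟪T y, x⟫_ℂ = 0 := fun y =>
    (Submodule.mem_orthogonal _ _).mp hx _ (mem_unboundedInv_domain.mpr ⟨y, rfl⟩)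
  refine LinearMap.ker_eq_bot'.mp hker x ?_
  refine ext_inner_left ℂ fun y => ?_
  rw [ContinuousLinearMap.coe_coe, ← inner_map_eq_of_isSelfAdjoint hT, hx', inner_zero_right]

/-- Maximality: the adjoint relation for (y, z), tested on vectors T x, reads ⟨z, T x⟩ = ⟨y, x⟩, so
y = T z lies in the range. -/
theorem isSelfAdjoint_unboundedInv {T : H →L[ℂ] H} (hT : IsSelfAdjoint T)
    (hker : LinearMap.ker (T : H →ₗ[ℂ] H) = ⊥) : IsSelfAdjoint (unboundedInv T) := by
  refine isSelfAdjoint_of_symmetric_of_maximal (dense_unboundedInv_domain hT hker)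
    (fun x y => ?_) fun y z h => mem_unboundedInv_domain.mpr ⟨z, ?_⟩
  · conv_lhs => rw [← apply_unboundedInv hker y]
    conv_rhs => rw [← apply_unboundedInv hker x]
    rw [inner_map_eq_of_isSelfAdjoint hT]
  · refine ext_inner_right ℂ fun x => ?_
    have hx : T x ∈ (unboundedInv T).domain := mem_unboundedInv_domain.mpr ⟨x, rfl⟩
    rw [inner_map_eq_of_isSelfAdjoint hT]
    have := h ⟨T x, hx⟩
    rwa [unboundedInv_apply_eq hker (x := x) rfl] at this

theorem isSelfAdjoint_toPMap_top {A : H →L[ℂ] H} (hA : IsSelfAdjoint A) :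
    IsSelfAdjoint ((A : H →ₗ[ℂ] H).toPMap ⊤) := by
  rw [LinearPMap.isSelfAdjoint_def,
    ContinuousLinearMap.toPMap_adjoint_eq_adjoint_toPMap_of_dense A (by simp)]
  rw [ContinuousLinearMap.isSelfAdjoint_iff'.mp hA]

/-- A self-adjoint operator that agrees with a bounded one on a dense subspace is that bounded
operator. -/
theorem eq_toPMap_top_of_eq_on_dense {A : H →L[ℂ] H} (hA : IsSelfAdjoint A) {K : H →ₗ.[ℂ] H}
    (hK : IsSelfAdjoint K) {D : Submodule ℂ H} (hd : Dense (D : Set H)) (hD : D ≤ K.domain)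
    (h : ∀ v : D, K (Submodule.inclusion hD v) = A v) : K = (A : H →ₗ[ℂ] H).toPMap ⊤ := by
  refine eq_of_le_of_isSelfAdjoint hK (isSelfAdjoint_toPMap_top hA) ⟨le_top, fun x y hxy => ?_⟩
  change K x = A y
  rw [← hxy]
  refine hd.eq_of_inner_left ℂ fun v hv => ?_
  rw [inner_apply_of_isSelfAdjoint hK x ⟨v, hD hv⟩, inner_map_eq_of_isSelfAdjoint hA]
  exact congrArg _ (h ⟨v, hv⟩)

/-! ### Forms factoring through an unbounded inverse -/

section Factor

variable {J A : H →L[ℂ] H} {F : (unboundedInv J).domain → (unboundedInv J).domain → ℂ}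

theorem isSemiboundedForm_of_eq_inner {D : Submodule ℂ H} (hD : Dense (D : Set H))
    (R : D →ₗ[ℂ] H) (hA : A.IsPositive) {F : D → D → ℂ}
    (hF : ∀ u v, F u v = ⟪R u, A (R v)⟫_ℂ) : IsSemiboundedForm D F where
  dense := hD
  sesquilinear := ⟨((innerₛₗ ℂ).comp R).compl₂ ((A : H →ₗ[ℂ] H).comp R), fun u v => hF u v⟩
  symm u v := by
    rw [hF, hF, inner_conj_symm, inner_map_eq_of_isSelfAdjoint hA.isSelfAdjoint]
  bounded_below := ⟨0, fun u => by
    rw [zero_mul, hF]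
    exact hA.re_inner_nonneg_right (R u)⟩

/-- Since A ≥ 1, a form-Cauchy sequence uₙ has J⁻¹uₙ Cauchy in norm; continuity of J identifies J of
the limit with w, and continuity of A gives form convergence. -/
theorem isClosedForm_of_eq_inner_unboundedInv (hker : LinearMap.ker (J : H →ₗ[ℂ] H) = ⊥)
    (hco : ∀ w, ‖w‖ ^ 2 ≤ (⟪w, A w⟫_ℂ).re)
    (hF : ∀ u v, F u v = ⟪unboundedInv J u, A (unboundedInv J v)⟫_ℂ) :
    IsClosedForm (unboundedInv J).domain F := by
  intro u w huw hcauchy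
  have hC : CauchySeq fun n => unboundedInv J (u n) := by
    rw [cauchySeq_iff_tendsto_dist_atTop_0]
    have h0 : Tendsto (fun p : ℕ × ℕ => √((F (u p.1 - u p.2) (u p.1 - u p.2)).re)) atTop (𝓝 0) := by
      have := (Complex.continuous_re.tendsto _).comp hcauchy
      simpa [Function.comp_def] using this.sqrt
    refine squeeze_zero (fun _ => dist_nonneg) (fun p => ?_) h0
    refine Real.le_sqrt_of_sq_le ?_
    rw [hF, dist_eq_norm, ← LinearPMap.map_sub]
    exact hco _
  obtain ⟨z, hz⟩ := cauchySeq_tendsto_of_complete hC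
  have hJz : J z = w := by
    refine tendsto_nhds_unique ((J.continuous.tendsto z).comp hz) ?_
    simpa only [Function.comp_def, apply_unboundedInv hker] using huw
  refine ⟨mem_unboundedInv_domain.mpr ⟨z, hJz⟩, ?_⟩
  simp only [hF, LinearPMap.map_sub, unboundedInv_apply_eq hker (y := ⟨w, _⟩) hJz]
  have h1 : Tendsto (fun n => unboundedInv J (u n) - z) atTop (𝓝 0) := by
    simpa using hz.sub_const z
  have h2 := h1.inner (𝕜 := ℂ) ((A.continuous.tendsto 0).comp h1)
  rwa [map_zero, inner_zero_right] at h2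

theorem definesLD_of_eq_inner_unboundedInv (ρ' : H →L[ℂ] H) (hJ : IsSelfAdjoint J)
    (hker : LinearMap.ker (J : H →ₗ[ℂ] H) = ⊥) (hA : IsSelfAdjoint A)
    (hco : ∀ w, ‖w‖ ^ 2 ≤ (⟪w, A w⟫_ℂ).re)
    (hF : ∀ u v, F u v = ⟪unboundedInv J u, A (unboundedInv J v)⟫_ℂ) :
    DefinesLD ρ' (unboundedInv J).domain F := by
  -- The bound `hco` sees only real parts; self-adjointness makes ⟨A x, x⟩ real, so it becomes an
  -- operator inequality, which yields invertibility.
  have h1A : (1 : H →L[ℂ] H) ≤ A := by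
    rw [ContinuousLinearMap.le_def, ContinuousLinearMap.isPositive_iff_complex]
    intro x
    have hreal : (starRingEnd ℂ) ⟪A x, x⟫_ℂ = ⟪A x, x⟫_ℂ := by
      rw [inner_conj_symm, inner_map_eq_of_isSelfAdjoint hA]
    have h2 := hco x
    rw [← inner_map_eq_of_isSelfAdjoint hA] at h2
    obtain ⟨r, hr⟩ := Complex.conj_eq_iff_real.mp hreal
    rw [hr, Complex.ofReal_re] at h2
    have h3 : ⟪(A - 1) x, x⟫_ℂ = ((r - ‖x‖ ^ 2 : ℝ) : ℂ) := by
      rw [sub_apply, one_apply_eq_self, inner_sub_left, inner_self_eq_norm_sq_to_K, hr]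
      push_cast
      rfl
    rw [h3]
    exact ⟨rfl, sub_nonneg.mpr h2⟩
  have hu : IsUnit A := CStarAlgebra.isUnit_of_le 1 h1A
  set B := Ring.inverse A with hB
  have hAB : ∀ x, A (B x) = x := fun x => by
    rw [← mul_apply_eq_comp, Ring.mul_inverse_cancel _ hu]; rfl
  have hBA : ∀ x, B (A x) = x := fun x => by
    rw [← mul_apply_eq_comp, Ring.inverse_mul_cancel _ hu]; rfl
  have hBs : IsSelfAdjoint B := by
    rw [ContinuousLinearMap.isSelfAdjoint_iff_isSymmetric]
    intro x y
    simp only [ContinuousLinearMap.coe_coe]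
    conv_lhs => rw [← hAB y]
    conv_rhs => rw [← hAB x]
    rw [inner_map_eq_of_isSelfAdjoint hA]
  have hJinj : ∀ x, J x = 0 → x = 0 := fun x => LinearMap.ker_eq_bot'.mp hker x
  -- The inverse of J A⁻¹ J is J⁻¹ A J⁻¹ on its natural domain, the operator that the form suggests.
  set T := J * B * J with hT
  have hTs : IsSelfAdjoint T := by
    have := hBs.conjugate J
    rwa [hJ.star_eq] at this
  have hTker : LinearMap.ker (T : H →ₗ[ℂ] H) = ⊥ := by
    rw [LinearMap.ker_eq_bot']
    intro x hx
    have h1 : B (J x) = 0 := hJinj _ hx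
    exact hJinj _ (by rw [← hAB (J x), h1, map_zero])
  have hle : (unboundedInv T).domain ≤ (unboundedInv J).domain := fun y hy => by
    obtain ⟨x, rfl⟩ := mem_unboundedInv_domain.mp hy
    exact mem_unboundedInv_domain.mpr ⟨B (J x), rfl⟩
  have hrep : Represents (unboundedInv J).domain F (unboundedInv T) := by
    refine ⟨isSelfAdjoint_unboundedInv hTs hTker, hle, fun u v => ?_⟩
    have hv : J (B (J (unboundedInv T v))) = v := apply_unboundedInv hTker v
    rw [hF, unboundedInv_apply_eq hker (y := Submodule.inclusion hle v) hv, hAB,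
      ← inner_map_eq_of_isSelfAdjoint hJ, apply_unboundedInv hker]
  refine ⟨unboundedInv T, hrep, fun K' hK' => ?_, isSelfAdjoint_unshift ρ' hrep.selfAdjoint⟩
  -- Testing on u = J w removes J⁻¹ from the first slot and gives A J⁻¹v = J K'v. Solving for v
  -- shows that K' is a restriction of T⁻¹.
  have key : ∀ v : K'.domain, T (K' v) = v := fun v => by
    set v' := Submodule.inclusion hK'.domain_le v
    have h1 : A (unboundedInv J v') = J (K' v) := by
      refine ext_inner_left ℂ fun w => ?_
      have hw : J w ∈ (unboundedInv J).domain := mem_unboundedInv_domain.mpr ⟨w, rfl⟩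
      have := hK'.apply_eq ⟨J w, hw⟩ v
      rw [hF, unboundedInv_apply_eq hker (x := w) rfl] at this
      rw [this, inner_map_eq_of_isSelfAdjoint hJ]
    change J (B (J (K' v))) = v
    rw [← h1, hBA, apply_unboundedInv hker]
    rfl
  refine eq_of_le_of_isSelfAdjoint hK'.selfAdjoint hrep.selfAdjoint
    ⟨fun v hv => mem_unboundedInv_domain.mpr ⟨_, key ⟨v, hv⟩⟩, fun v y hvy => ?_⟩
  exact (unboundedInv_apply_eq hTker ((key v).trans hvy)).symm

end Factor

/-! ### Bounded forms -/

section Bounded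

variable {A : H →L[ℂ] H}

theorem definesLD_top (ρ' : H →L[ℂ] H) (hA : IsSelfAdjoint A)
    {F : (⊤ : Submodule ℂ H) → (⊤ : Submodule ℂ H) → ℂ}
    (hF : ∀ u v, F u v = ⟪(u : H), A v⟫_ℂ) : DefinesLD ρ' ⊤ F := by
  have hs := isSelfAdjoint_toPMap_top hA
  refine ⟨_, ⟨hs, le_rfl, fun u v => hF u v⟩, fun K' hK' => ?_, isSelfAdjoint_unshift ρ' hs⟩
  refine eq_toPMap_top_of_eq_on_dense hA hK'.selfAdjoint hK'.selfAdjoint.dense_domain le_rfl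
    fun v => ext_inner_left ℂ fun u => ?_
  exact (hK'.apply_eq ⟨u, trivial⟩ v).symm.trans (hF _ _)

/-- For a bounded form, norm convergence implies form convergence; closedness is then automatic and
a core is just a dense subspace. -/
theorem isFormClosure_top (hA : A.IsPositive) {D : Submodule ℂ H} (hD : Dense (D : Set H))
    {F : D → D → ℂ} (hF : ∀ u v, F u v = ⟪(u : H), A v⟫_ℂ)
    {F' : (⊤ : Submodule ℂ H) → (⊤ : Submodule ℂ H) → ℂ}
    (hF' : ∀ u v, F' u v = ⟪(u : H), A v⟫_ℂ) : IsFormClosure D F ⊤ F' := by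
  have hlim : ∀ (u : ℕ → (⊤ : Submodule ℂ H)) (w : (⊤ : Submodule ℂ H)),
      Tendsto (fun n => (u n : H)) atTop (𝓝 (w : H)) →
      Tendsto (fun n => F' (u n - w) (u n - w)) atTop (𝓝 0) := fun u w h => by
    have h1 : Tendsto (fun n => (u n : H) - w) atTop (𝓝 0) := by simpa using h.sub_const (w : H)
    have := h1.inner (𝕜 := ℂ) ((A.continuous.tendsto 0).comp h1)
    rw [map_zero, inner_zero_right] at this
    exact this.congr fun n => (hF' _ _).symm
  refine ⟨isSemiboundedForm_of_eq_inner (by simp) (Submodule.subtype _) hA hF',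
    fun u w hu _ => ⟨trivial, hlim u ⟨w, trivial⟩ hu⟩, le_top,
    fun u v => by rw [hF, hF']; rfl, fun w => ?_⟩
  obtain ⟨u, hu, hlu⟩ := mem_closure_iff_seq_limit.mp (hD (w : H))
  exact ⟨fun n => ⟨u n, hu n⟩, hlu, hlim _ w hlu⟩

theorem existsUnique_isSelfAdjoint_of_bounded (hA : IsSelfAdjoint A) {D : Submodule ℂ H}
    (hD : Dense (D : Set H)) {F : D → D → ℂ} (hF : ∀ u v, F u v = ⟪(u : H), A v⟫_ℂ) :
    ∃! K : H →ₗ.[ℂ] H, IsSelfAdjoint K ∧ ∃ hDK : D ≤ K.domain, ∀ u v : D,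
      F u v = ⟪(u : H), K (Submodule.inclusion hDK v)⟫_ℂ := by
  refine ⟨(A : H →ₗ[ℂ] H).toPMap ⊤, ⟨isSelfAdjoint_toPMap_top hA, le_top, fun u v => hF u v⟩, ?_⟩
  rintro K ⟨hK, hDK, h⟩
  refine eq_toPMap_top_of_eq_on_dense hA hK hD hDK fun v => ?_
  exact hD.eq_of_inner_right ℂ fun u hu => (h ⟨u, hu⟩ v).symm.trans (hF _ _)

end Bounded

/-! ### The weak-star derivative of a curve of states -/

/-- Parseval's identity. Rank one operators are compact, so weak* differentiability yields
differentiability of all matrix elements. -/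
theorem trace_mul_rankOne (T : H →L[ℂ] H) (x y : H) :
    trace (T * InnerProductSpace.rankOne ℂ x y) = ⟪y, T x⟫_ℂ := by
  rw [trace, ← (basis H).tsum_inner_mul_inner]
  refine tsum_congr fun i => ?_
  rw [mul_apply_eq_comp, InnerProductSpace.rankOne_apply, map_smul, inner_smul_right]

theorem isCompactOperator_rankOne (x y : H) :
    IsCompactOperator (InnerProductSpace.rankOne ℂ x y : H →L[ℂ] H) := by
  rw [InnerProductSpace.rankOne_def']
  exact (isCompactOperator_of_locallyCompactSpace_dom (innerSL ℂ y)).clm_comp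
    (ContinuousLinearMap.toSpanSingleton ℂ x)

theorem hasDerivWithinAt_inner_of_hasWeakStarDerivWithinAt {ρ : ℝ → H →L[ℂ] H} {ρ' : H →L[ℂ] H}
    {I : Set ℝ} {θ : ℝ} (h : HasWeakStarDerivWithinAt ρ ρ' I θ) (x y : H) :
    HasDerivWithinAt (fun t => ⟪y, ρ t x⟫_ℂ) ⟪y, ρ' x⟫_ℂ I θ := by
  simpa only [trace_mul_rankOne] using
    h.2 (InnerProductSpace.rankOne ℂ x y) (isCompactOperator_rankOne x y)

theorem isSelfAdjoint_of_hasWeakStarDerivWithinAt {ρ : ℝ → H →L[ℂ] H} {ρ' : H →L[ℂ] H}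
    {I : Set ℝ} (hI : I.OrdConnected) (hI' : I.Nontrivial) (hρ : ∀ t ∈ I, IsSelfAdjoint (ρ t))
    {θ : ℝ} (hθ : θ ∈ I) (h : HasWeakStarDerivWithinAt ρ ρ' I θ) : IsSelfAdjoint ρ' := by
  -- A nondegenerate interval determines one-sided derivatives too, so the end points need no
  -- separate treatment.
  have hu : UniqueDiffWithinAt ℝ I θ :=
    uniqueDiffWithinAt_convex hI.convex
      ((hI.convex.nontrivial_iff_nonempty_interior).mp hI') (subset_closure hθ)
  rw [ContinuousLinearMap.isSelfAdjoint_iff_isSymmetric]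
  intro x y
  have h1 := hasDerivWithinAt_inner_of_hasWeakStarDerivWithinAt h x y
  have h2 := hasDerivWithinAt_inner_of_hasWeakStarDerivWithinAt h y x
  have h3 : HasDerivWithinAt (fun t => ⟪x, ρ t y⟫_ℂ) (starRingEnd ℂ ⟪y, ρ' x⟫_ℂ) I θ := by
    refine (h1.star).congr_of_mem (fun t ht => ?_) hθ
    rw [← inner_map_eq_of_isSelfAdjoint (hρ t ht), ← inner_conj_symm]
    rfl
  have := hu.eq_deriv _ h3 h2
  rw [inner_conj_symm] at this
  exact this

theorem isSelfAdjoint_shifted {ρ' : H →L[ℂ] H} (h : IsSelfAdjoint ρ') :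
    IsSelfAdjoint (shifted ρ') := by
  refine h.add ?_
  rw [isSelfAdjoint_iff, star_smul, star_one]
  simp

theorem norm_sq_le_re_inner_shifted (ρ' : H →L[ℂ] H) (w : H) :
    ‖w‖ ^ 2 ≤ (⟪w, shifted ρ' w⟫_ℂ).re := by
  have h1 : -(‖ρ'‖ * ‖w‖ ^ 2) ≤ (⟪w, ρ' w⟫_ℂ).re := by
    have h2 := (Complex.abs_re_le_norm _).trans (norm_inner_le_norm (𝕜 := ℂ) w (ρ' w))
    have h3 := mul_le_mul_of_nonneg_left (ρ'.le_opNorm w) (norm_nonneg w)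
    have h4 := neg_abs_le (⟪w, ρ' w⟫_ℂ).re
    nlinarith
  have h2 : (⟪w, shifted ρ' w⟫_ℂ).re = (⟪w, ρ' w⟫_ℂ).re + (‖ρ'‖ + 1) * ‖w‖ ^ 2 := by
    have : shifted ρ' w = ρ' w + ((‖ρ'‖ + 1 : ℝ) : ℂ) • w := rfl
    rw [this, inner_add_right, inner_smul_right, inner_self_eq_norm_sq_to_K, Complex.add_re,
      Complex.re_ofReal_mul]
    congr 2
    exact (congrArg Complex.re (Complex.ofReal_pow ‖w‖ 2)).symm.trans (Complex.ofReal_re _)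
  rw [h2]
  linarith

theorem isPositive_of_re_inner_nonneg {S : H →L[ℂ] H} (hS : IsSelfAdjoint S)
    (hco : ∀ w, 0 ≤ (⟪w, S w⟫_ℂ).re) : S.IsPositive := by
  refine ⟨ContinuousLinearMap.isSelfAdjoint_iff_isSymmetric.mp hS, fun x => ?_⟩
  rw [ContinuousLinearMap.reApplyInnerSelf_apply, inner_map_eq_of_isSelfAdjoint hS]
  exact hco x

/-! ### Averages of bounded forms -/

section Average

variable {α : Type*} [MeasurableSpace α] {μ : Measure α} {T : α → H →L[ℂ] H} {S : H →L[ℂ] H}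

/-- A sum of squares in place of the product allows integration without a Cauchy–Schwarz inequality
for integrals. -/
theorem norm_inner_map_le_norm_sq_add_norm_sq (S : H →L[ℂ] H) (u v : H) :
    ‖⟪u, S v⟫_ℂ‖ ≤ ‖S‖ * (‖u‖ ^ 2 + ‖v‖ ^ 2) := by
  have h1 := norm_inner_le_norm (𝕜 := ℂ) u (S v)
  have h2 := mul_le_mul_of_nonneg_left (S.le_opNorm v) (norm_nonneg u)
  have h3 : ‖u‖ * ‖v‖ ≤ ‖u‖ ^ 2 + ‖v‖ ^ 2 := by
    nlinarith [sq_nonneg (‖u‖ - ‖v‖), sq_nonneg ‖u‖, sq_nonneg ‖v‖]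
  have h4 := mul_le_mul_of_nonneg_left h3 (norm_nonneg S)
  linarith

theorem integrable_inner_average (hm : ∀ w, AEStronglyMeasurable (fun x => T x w) μ)
    (hi : ∀ w, Integrable (fun x => ‖T x w‖ ^ 2) μ) (u v : H) :
    Integrable (fun x => ⟪T x u, S (T x v)⟫_ℂ) μ := by
  refine (((hi u).add (hi v)).const_mul ‖S‖).mono'
    ((hm u).inner (S.continuous.comp_aestronglyMeasurable (hm v))) (.of_forall fun x => ?_)
  exact norm_inner_map_le_norm_sq_add_norm_sq S _ _

/-- The form `∫ ⟨T x u, S T x v⟩ dμ(x)` is given by a bounded operator. -/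
theorem exists_average (hm : ∀ w, AEStronglyMeasurable (fun x => T x w) μ)
    (hi : ∀ w, Integrable (fun x => ‖T x w‖ ^ 2) μ) {C : ℝ}
    (hC : ∀ w, ∫ x, ‖T x w‖ ^ 2 ∂μ ≤ C * ‖w‖ ^ 2) (hS : IsSelfAdjoint S)
    (hco : ∀ w, ‖w‖ ^ 2 ≤ (⟪w, S w⟫_ℂ).re) :
    ∃ A : H →L[ℂ] H, IsSelfAdjoint A ∧ (∀ w, ∫ x, ‖T x w‖ ^ 2 ∂μ ≤ (⟪w, A w⟫_ℂ).re) ∧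
      ∀ u v, ∫ x, ⟪T x u, S (T x v)⟫_ℂ ∂μ = ⟪u, A v⟫_ℂ := by
  have hI := integrable_inner_average (S := S) hm hi
  let B : H →ₗ⋆[ℂ] H →ₗ[ℂ] ℂ := LinearMap.mk₂'ₛₗ (starRingEnd ℂ) (RingHom.id ℂ)
    (fun u v => ∫ x, ⟪T x u, S (T x v)⟫_ℂ ∂μ)
    (fun u u' v => by simp only [map_add, inner_add_left]; exact integral_add (hI u v) (hI u' v))
    (fun c u v => by
      simp only [map_smul, inner_smul_left, integral_const_mul, smul_eq_mul])
    (fun u v v' => by simp only [map_add, inner_add_right]; exact integral_add (hI u v) (hI u v'))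
    (fun c u v => by
      simp only [map_smul, inner_smul_right, integral_const_mul, smul_eq_mul, RingHom.id_apply])
  have hB1 : ∀ u v, ‖B u v‖ ≤ ‖S‖ * (C * ‖u‖ ^ 2 + C * ‖v‖ ^ 2) := fun u v => by
    refine (norm_integral_le_of_norm_le (((hi u).add (hi v)).const_mul ‖S‖)
      (.of_forall fun x => ?_)).trans ?_
    · exact norm_inner_map_le_norm_sq_add_norm_sq S _ _
    · rw [integral_const_mul]
      simp only [Pi.add_apply]
      rw [integral_add (hi u) (hi v)]
      exact mul_le_mul_of_nonneg_left (add_le_add (hC u) (hC v)) (norm_nonneg S)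
  -- Applying the sum-of-squares bound to unit vectors and using homogeneity turns it into a product
  -- bound.
  have hB2 : ∀ u v, ‖B u v‖ ≤ ‖S‖ * (2 * C) * ‖u‖ * ‖v‖ := fun u v => by
    rcases eq_or_ne u 0 with rfl | hu
    · simp
    rcases eq_or_ne v 0 with rfl | hv
    · simp
    have h := hB1 (((‖u‖ : ℂ)⁻¹) • u) (((‖v‖ : ℂ)⁻¹) • v)
    have hu0 : 0 < ‖u‖ := norm_pos_iff.mpr hu
    have hv0 : 0 < ‖v‖ := norm_pos_iff.mpr hv
    have hu1 : ‖((‖u‖ : ℂ)⁻¹) • u‖ = 1 := norm_smul_inv_norm (𝕜 := ℂ) hu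
    have hv1 : ‖((‖v‖ : ℂ)⁻¹) • v‖ = 1 := norm_smul_inv_norm (𝕜 := ℂ) hv
    rw [hu1, hv1, LinearMap.map_smulₛₗ₂, map_smul, norm_smul, norm_smul] at h
    simp only [map_inv₀, Complex.conj_ofReal, norm_inv, Complex.norm_real, norm_norm] at h
    rw [inv_mul_le_iff₀ hu0, inv_mul_le_iff₀ hv0] at h
    linarith
  let A : H →L[ℂ] H :=
    InnerProductSpace.continuousLinearMapOfBilin (LinearMap.mkContinuous₂ B (‖S‖ * (2 * C)) hB2)
  have hAB : ∀ u v, ⟪A u, v⟫_ℂ = B u v := fun u v =>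
    InnerProductSpace.continuousLinearMapOfBilin_apply _ u v
  have hA : IsSelfAdjoint A := by
    rw [ContinuousLinearMap.isSelfAdjoint_iff_isSymmetric]
    intro u v
    rw [ContinuousLinearMap.coe_coe, hAB, ← inner_conj_symm, hAB]
    change ∫ x, ⟪T x u, S (T x v)⟫_ℂ ∂μ = starRingEnd ℂ (∫ x, ⟪T x v, S (T x u)⟫_ℂ ∂μ)
    rw [← integral_conj]
    refine integral_congr_ae (.of_forall fun x => ?_)
    simp only [inner_conj_symm, inner_map_eq_of_isSelfAdjoint hS]
  have hA' : ∀ u v, ∫ x, ⟪T x u, S (T x v)⟫_ℂ ∂μ = ⟪u, A v⟫_ℂ := fun u v => by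
    rw [← inner_map_eq_of_isSelfAdjoint hA, hAB]
    rfl
  refine ⟨A, hA, fun w => ?_, hA'⟩
  rw [← hA', ← RCLike.re_to_complex, ← integral_re (hI w w)]
  exact integral_mono (hi w) (hI w w).re fun x => hco _

end Average

/-! ### Bounds on the spectrum of a positive operator -/

theorem spectrum_real_nonneg {ρ : H →L[ℂ] H} (hρ : 0 ≤ ρ) {l : ℝ} (hl : l ∈ spectrum ℝ ρ) :
    0 ≤ l :=
  spectrum_nonneg_of_nonneg hρ hl

/-- The extra 1 keeps the bound strictly positive even for ρ = 0, so that its inverse can serve as a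
decay rate. In the trivial algebra the spectrum is empty. -/
theorem le_norm_of_mem_spectrum_real {ρ : H →L[ℂ] H} {l : ℝ} (hl : l ∈ spectrum ℝ ρ) :
    l ≤ ‖ρ‖ + 1 := by
  have : Nontrivial (H →L[ℂ] H) := by
    by_contra h
    rw [not_nontrivial_iff_subsingleton] at h
    rw [spectrum.of_subsingleton] at hl
    exact hl
  have h1 := spectrum.norm_le_norm_of_mem hl
  have h2 := le_abs_self l
  rw [Real.norm_eq_abs] at h1
  linarith

/-! ### The semigroup generated by the inverse -/

theorem exp_neg_div_le {s l : ℝ} (hs : 0 < s) (hl : 0 < l) :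
    Real.exp (-s / (2 * l)) ≤ 2 * l / s := by
  have h1 : s / (2 * l) ≤ Real.exp (s / (2 * l)) := by
    linarith [Real.add_one_le_exp (s / (2 * l))]
  rw [neg_div, Real.exp_neg, inv_le_comm₀ (Real.exp_pos _) (by positivity), inv_div]
  exact h1

/-- Joint continuity up to l = 0, where e^{-s/(2l)} ≤ 2l/s squeezes the function to its value 0. It
makes the functional calculus measurable in s. -/
theorem continuousOn_exp_neg_div :
    ContinuousOn (Function.uncurry fun s l : ℝ => if l = 0 then 0 else Real.exp (-s / (2 * l)))
      (Set.Ioi 0 ×ˢ Set.Ici 0) := by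
  rintro ⟨s, l⟩ ⟨hs, hl⟩
  rcases (Set.mem_Ici.mp hl).eq_or_lt with rfl | hl
  · have h0 : Tendsto (fun p : ℝ × ℝ => 2 * p.2 / p.1) (𝓝[Set.Ioi 0 ×ˢ Set.Ici 0] (s, 0)) (𝓝 0) := by
      have : ContinuousAt (fun p : ℝ × ℝ => 2 * p.2 / p.1) (s, 0) :=
        (continuousAt_const.mul continuousAt_snd).div continuousAt_fst (ne_of_gt hs)
      have h := this.tendsto
      simp only [mul_zero, zero_div] at h
      exact h.mono_left nhdsWithin_le_nhds
    rw [ContinuousWithinAt]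
    simp only [Function.uncurry, if_true]
    refine squeeze_zero' (.of_forall fun p => ?_) ?_ h0
    · dsimp only [Function.uncurry]
      split_ifs
      exacts [le_rfl, (Real.exp_pos _).le]
    · filter_upwards [self_mem_nhdsWithin] with p hp
      dsimp only [Function.uncurry]
      split_ifs with h
      · simp [h]
      · exact exp_neg_div_le hp.1 (lt_of_le_of_ne hp.2 (Ne.symm h))
  · refine ContinuousAt.continuousWithinAt ?_
    have : ContinuousAt (fun p : ℝ × ℝ => Real.exp (-p.1 / (2 * p.2))) (s, l) :=
      (continuousAt_fst.neg.div (continuousAt_const.mul continuousAt_snd)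
        (by simpa using hl.ne')).rexp
    refine this.congr ?_
    filter_upwards [(isOpen_ne_fun continuous_snd continuous_const).mem_nhds hl.ne'] with p hp
    exact (if_neg hp).symm

section Tilde

variable {ρ : H →L[ℂ] H}

theorem norm_exp_neg_div_le (hρ : 0 ≤ ρ) {s l : ℝ} (hs : 0 < s) (hl : l ∈ spectrum ℝ ρ) :
    ‖if l = 0 then 0 else Real.exp (-s / (2 * l))‖ ≤ Real.exp (-(2 * (‖ρ‖ + 1))⁻¹ * s) := by
  have h0 := spectrum_real_nonneg hρ hl
  split_ifs with h
  · simpa using Real.exp_nonneg _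
  · have h1 := le_norm_of_mem_spectrum_real hl
    have h2 : 0 < l := lt_of_le_of_ne h0 (Ne.symm h)
    rw [Real.norm_eq_abs, Real.abs_exp, Real.exp_le_exp, neg_div, neg_mul, neg_le_neg_iff,
      div_eq_inv_mul]
    gcongr

theorem norm_expInvSemigroup_le (hρ : 0 ≤ ρ) {s : ℝ} (hs : 0 < s) :
    ‖expInvSemigroup ρ s‖ ≤ Real.exp (-(2 * (‖ρ‖ + 1))⁻¹ * s) :=
  norm_cfc_le (Real.exp_nonneg _) fun _ hl => norm_exp_neg_div_le hρ hs hl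

theorem integrableOn_expInvSemigroup (hρ : 0 ≤ ρ) :
    IntegrableOn (expInvSemigroup ρ) (Set.Ioi 0) := by
  refine integrableOn_cfc measurableSet_Ioi _ (fun s => Real.exp (-(2 * (‖ρ‖ + 1))⁻¹ * s)) ρ
    (continuousOn_exp_neg_div.mono (Set.prod_mono le_rfl fun l hl => spectrum_real_nonneg hρ hl))
    ?_ ?_ (IsSelfAdjoint.of_nonneg hρ)
  · filter_upwards [ae_restrict_mem measurableSet_Ioi] with s hs l hl
    exact norm_exp_neg_div_le hρ hs hl
  · exact (integrableOn_exp_mul_Ioi (neg_neg_of_pos (by positivity)) 0).hasFiniteIntegral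

theorem aestronglyMeasurable_expInvSemigroup_apply (hρ : 0 ≤ ρ) (w : H) :
    AEStronglyMeasurable (fun s => expInvSemigroup ρ s w) (volume.restrict (Set.Ioi 0)) :=
  (ContinuousLinearMap.apply ℂ H w).continuous.comp_aestronglyMeasurable
    (integrableOn_expInvSemigroup hρ).aestronglyMeasurable

theorem norm_expInvSemigroup_apply_sq_le (hρ : 0 ≤ ρ) {s : ℝ} (hs : 0 < s) (w : H) :
    ‖expInvSemigroup ρ s w‖ ^ 2 ≤ Real.exp (-(‖ρ‖ + 1)⁻¹ * s) * ‖w‖ ^ 2 := by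
  have h1 : ‖expInvSemigroup ρ s w‖ ≤ Real.exp (-(2 * (‖ρ‖ + 1))⁻¹ * s) * ‖w‖ :=
    (ContinuousLinearMap.le_opNorm _ _).trans
      (mul_le_mul_of_nonneg_right (norm_expInvSemigroup_le hρ hs) (norm_nonneg w))
  have h2 : Real.exp (-(2 * (‖ρ‖ + 1))⁻¹ * s) ^ 2 = Real.exp (-(‖ρ‖ + 1)⁻¹ * s) := by
    rw [← Real.exp_nat_mul, mul_inv]
    congr 1
    push_cast
    ring
  calc _ ≤ (Real.exp (-(2 * (‖ρ‖ + 1))⁻¹ * s) * ‖w‖) ^ 2 := by gcongr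
    _ = _ := by rw [mul_pow, h2]

theorem integrableOn_norm_expInvSemigroup_sq (hρ : 0 ≤ ρ) (w : H) :
    IntegrableOn (fun s => ‖expInvSemigroup ρ s w‖ ^ 2) (Set.Ioi 0) := by
  refine Integrable.mono' ((integrableOn_exp_mul_Ioi
    (a := -(‖ρ‖ + 1)⁻¹) (neg_neg_of_pos (by positivity)) 0).mul_const (‖w‖ ^ 2))
    ((aestronglyMeasurable_expInvSemigroup_apply hρ w).norm.pow 2) ?_
  filter_upwards [ae_restrict_mem measurableSet_Ioi] with s hs
  rw [norm_pow, norm_norm]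
  exact norm_expInvSemigroup_apply_sq_le hρ hs w

theorem integral_norm_expInvSemigroup_sq_le (hρ : 0 ≤ ρ) (w : H) :
    ∫ s in Set.Ioi (0 : ℝ), ‖expInvSemigroup ρ s w‖ ^ 2 ≤
      (∫ s in Set.Ioi (0 : ℝ), Real.exp (-(‖ρ‖ + 1)⁻¹ * s)) * ‖w‖ ^ 2 := by
  rw [← integral_mul_const]
  refine setIntegral_mono_on (integrableOn_norm_expInvSemigroup_sq hρ w)
    ((integrableOn_exp_mul_Ioi (neg_neg_of_pos (by positivity)) 0).mul_const _) measurableSet_Ioi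
    fun s hs => norm_expInvSemigroup_apply_sq_le hρ hs w

end Tilde

/-! ### Strong limits -/

theorem tendsto_apply_zero_of_dense {ι : Type*} {l : Filter ι} {B : ι → H →L[ℂ] H} {D : Set H}
    (hD : Dense D) (hB : ∀ᶠ i in l, ‖B i‖ ≤ 1) (h : ∀ w ∈ D, Tendsto (fun i => B i w) l (𝓝 0))
    (w : H) : Tendsto (fun i => B i w) l (𝓝 0) := by
  rw [Metric.tendsto_nhds]
  intro ε hε
  obtain ⟨v, hv, hwv⟩ := hD.exists_dist_lt w (half_pos hε)
  filter_upwards [hB, Metric.tendsto_nhds.mp (h v hv) _ (half_pos hε)] with i hi1 hi2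
  rw [dist_zero_right] at hi2 ⊢
  have h1 : ‖B i (w - v)‖ ≤ 1 * ‖w - v‖ := (B i).le_of_opNorm_le hi1 _
  rw [map_sub, one_mul, ← dist_eq_norm w v] at h1
  have h2 := norm_sub_norm_le (B i w) (B i v)
  linarith

/-- The square root of an injective positive operator is injective. -/
theorem ker_sqrt_eq_bot {ρ : H →L[ℂ] H} (hρ : 0 ≤ ρ)
    (hker : LinearMap.ker (ρ : H →ₗ[ℂ] H) = ⊥) :
    LinearMap.ker ((CFC.sqrt ρ : H →L[ℂ] H) : H →ₗ[ℂ] H) = ⊥ := by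
  rw [LinearMap.ker_eq_bot'] at hker ⊢
  intro x hx
  refine hker x ?_
  rw [ContinuousLinearMap.coe_coe] at hx ⊢
  rw [← CFC.sqrt_mul_sqrt_self ρ hρ, mul_apply_eq_comp, hx, map_zero]

theorem isSelfAdjoint_sqrt (ρ : H →L[ℂ] H) : IsSelfAdjoint (CFC.sqrt ρ) :=
  .of_nonneg (CFC.sqrt_nonneg ρ)

theorem commute_sqrt {ρ : H →L[ℂ] H} (hρ : 0 ≤ ρ) : Commute ρ (CFC.sqrt ρ) := by
  have h := CFC.sqrt_mul_sqrt_self ρ hρ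
  rw [commute_iff_eq, ← h, CFC.sqrt_mul_self _ (CFC.sqrt_nonneg ρ), mul_assoc]

/-- `‖T ρ^{1/2} w‖² = ⟨w, ρ T² w⟩` for `T` self-adjoint and commuting with `ρ^{1/2}`. -/
theorem norm_apply_sqrt_sq {ρ T : H →L[ℂ] H} (hρ : 0 ≤ ρ) (hT : IsSelfAdjoint T)
    (hc : Commute T (CFC.sqrt ρ)) (w : H) :
    ‖T (CFC.sqrt ρ w)‖ ^ 2 = (⟪w, (ρ * (T * T)) w⟫_ℂ).re := by
  have h1 : ρ * (T * T) = CFC.sqrt ρ * (T * (T * CFC.sqrt ρ)) := by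
    rw [hc.eq, ← mul_assoc T, hc.eq, mul_assoc, ← mul_assoc (CFC.sqrt ρ),
      CFC.sqrt_mul_sqrt_self ρ hρ]
  have h2 : (ρ * (T * T)) w = CFC.sqrt ρ (T (T (CFC.sqrt ρ w))) := by rw [h1]; rfl
  rw [h2, ← inner_map_eq_of_isSelfAdjoint (isSelfAdjoint_sqrt ρ),
    ← inner_map_eq_of_isSelfAdjoint hT, ← RCLike.re_to_complex, inner_self_eq_norm_sq]

variable {ρ : H →L[ℂ] H}

theorem dense_range_of_isSelfAdjoint (hρ : IsSelfAdjoint ρ)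
    (hker : LinearMap.ker (ρ : H →ₗ[ℂ] H) = ⊥) : Dense (Set.range ρ) := by
  refine (dense_unboundedInv_domain hρ hker).mono fun y hy => ?_
  exact mem_unboundedInv_domain.mp hy

/-! ### The resolvent -/

section Resolvent

variable {x : ℝ}

theorem add_smul_one_mul_cfc_inv (hρ : 0 ≤ ρ) (hx : 0 < x) :
    (ρ + (x : ℂ) • (1 : H →L[ℂ] H)) * cfc (fun l : ℝ => (l + x)⁻¹) ρ = 1 := by
  have hs : IsSelfAdjoint ρ := .of_nonneg hρ
  have hne : ∀ l ∈ spectrum ℝ ρ, l + x ≠ 0 := fun l hl =>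
    (add_pos_of_nonneg_of_pos (spectrum_real_nonneg hρ hl) hx).ne'
  have h1 : ρ + (x : ℂ) • (1 : H →L[ℂ] H) = cfc (fun l : ℝ => l + x) ρ := by
    rw [cfc_add_const x (fun l : ℝ => l) ρ, cfc_id' ℝ ρ, Algebra.algebraMap_eq_smul_one]
    rfl
  have hc : ContinuousOn (fun l : ℝ => (l + x)⁻¹) (spectrum ℝ ρ) :=
    (by fun_prop : ContinuousOn (fun l : ℝ => l + x) _).inv₀ hne
  rw [h1, ← cfc_mul (fun l : ℝ => l + x) _ ρ (by fun_prop) hc,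
    cfc_congr (g := fun _ => (1 : ℝ)) (fun l hl => mul_inv_cancel₀ (hne l hl)), cfc_const_one ℝ ρ]

theorem commute_add_smul_one_cfc (hρ : 0 ≤ ρ) (f : ℝ → ℝ) :
    Commute (ρ + (x : ℂ) • (1 : H →L[ℂ] H)) (cfc f ρ) := by
  have hs : IsSelfAdjoint ρ := .of_nonneg hρ
  refine Commute.add_left ?_ ((Commute.one_left _).smul_left _)
  have := cfc_commute_cfc (fun l : ℝ => l) f ρ
  rwa [cfc_id' ℝ ρ] at this

theorem isUnit_add_smul_one (hρ : 0 ≤ ρ) (hx : 0 < x) :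
    IsUnit (ρ + (x : ℂ) • (1 : H →L[ℂ] H)) := by
  have h := add_smul_one_mul_cfc_inv hρ hx
  exact ⟨⟨_, _, h, (commute_add_smul_one_cfc hρ _).eq.symm.trans h⟩, rfl⟩

theorem resolv_eq_cfc (hρ : 0 ≤ ρ) (hx : 0 < x) :
    resolv ρ x = cfc (fun l : ℝ => (l + x)⁻¹) ρ := by
  have h := congrArg (resolv ρ x * ·) (add_smul_one_mul_cfc_inv hρ hx)
  simp only [mul_one] at h
  rw [← h, ← mul_assoc, resolv, Ring.inverse_mul_cancel _ (isUnit_add_smul_one hρ hx), one_mul]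

theorem isSelfAdjoint_resolv (hρ : 0 ≤ ρ) (hx : 0 < x) : IsSelfAdjoint (resolv ρ x) := by
  rw [resolv_eq_cfc hρ hx]
  exact cfc_predicate _ ρ

theorem norm_resolv_le (hρ : 0 ≤ ρ) (hx : 0 < x) : ‖resolv ρ x‖ ≤ x⁻¹ := by
  rw [resolv_eq_cfc hρ hx]
  refine norm_cfc_le (inv_nonneg.mpr hx.le) fun l hl => ?_
  have hl := spectrum_real_nonneg hρ hl
  rw [norm_inv, Real.norm_of_nonneg (by positivity)]
  exact inv_anti₀ hx (by linarith)

theorem commute_resolv_sqrt (hρ : 0 ≤ ρ) (hx : 0 < x) :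
    Commute (resolv ρ x) (CFC.sqrt ρ) := by
  have h : Commute (ρ + (x : ℂ) • (1 : H →L[ℂ] H)) (CFC.sqrt ρ) :=
    (commute_sqrt hρ).add_left ((Commute.one_left _).smul_left _)
  obtain ⟨u, hu⟩ := isUnit_add_smul_one hρ hx
  rw [resolv, ← hu, Ring.inverse_unit]
  rw [← hu] at h
  exact h.units_inv_left

theorem mul_resolv (hρ : 0 ≤ ρ) (hx : 0 < x) :
    ρ * resolv ρ x = 1 - (x : ℂ) • resolv ρ x := by
  have := Ring.mul_inverse_cancel _ (isUnit_add_smul_one hρ hx)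
  rw [add_mul, smul_mul_assoc, one_mul] at this
  exact eq_sub_of_add_eq this

theorem resolv_mul (hρ : 0 ≤ ρ) (hx : 0 < x) :
    resolv ρ x * ρ = 1 - (x : ℂ) • resolv ρ x := by
  have := Ring.inverse_mul_cancel _ (isUnit_add_smul_one hρ hx)
  rw [mul_add, mul_smul_comm, mul_one] at this
  exact eq_sub_of_add_eq this

theorem hasDerivAt_resolv (hρ : 0 ≤ ρ) (hx : 0 < x) :
    HasDerivAt (resolv ρ) (-(resolv ρ x * resolv ρ x)) x := by
  have h1 : HasDerivAt (fun y : ℝ => ρ + (y : ℂ) • (1 : H →L[ℂ] H)) 1 x := by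
    have := (((hasDerivAt_id x).ofReal_comp).smul_const (1 : H →L[ℂ] H)).const_add ρ
    simpa using this
  obtain ⟨u, hu⟩ := isUnit_add_smul_one hρ hx
  have h2 := hasFDerivAt_ringInverse (𝕜 := ℝ) u
  rw [hu] at h2
  have h3 := h2.comp_hasDerivAt x h1
  have h4 : resolv ρ x = ↑u⁻¹ := by rw [resolv, ← hu, Ring.inverse_unit]
  have h5 : (-ContinuousLinearMap.mulLeftRight ℝ (H →L[ℂ] H) ↑u⁻¹ ↑u⁻¹) 1 =
      -((↑u⁻¹ : H →L[ℂ] H) * ↑u⁻¹) := by simp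
  rw [h5] at h3
  rw [h4]
  exact h3

theorem continuousOn_resolv (hρ : 0 ≤ ρ) : ContinuousOn (resolv ρ) (Set.Ioi 0) := fun _ hx =>
  (hasDerivAt_resolv hρ hx).continuousAt.continuousWithinAt

theorem norm_smul_resolv_le (hρ : 0 ≤ ρ) (hx : 0 < x) : ‖(x : ℂ) • resolv ρ x‖ ≤ 1 := by
  rw [norm_smul, Complex.norm_real, Real.norm_of_nonneg hx.le]
  calc x * ‖resolv ρ x‖ ≤ x * x⁻¹ := by gcongr; exact norm_resolv_le hρ hx
    _ = 1 := mul_inv_cancel₀ hx.ne'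

/-- On the range of ρ, x(ρ+x)⁻¹ρy = x(y - x(ρ+x)⁻¹y) = O(x). The range is dense because ρ is
injective, and x(ρ+x)⁻¹ is a contraction. -/
theorem tendsto_smul_resolv_zero (hρ : 0 ≤ ρ) (hker : LinearMap.ker (ρ : H →ₗ[ℂ] H) = ⊥) (w : H) :
    Tendsto (fun x : ℝ => ((x : ℂ) • resolv ρ x) w) (𝓝[>] 0) (𝓝 0) := by
  refine tendsto_apply_zero_of_dense (dense_range_of_isSelfAdjoint (.of_nonneg hρ) hker) ?_ ?_ w
  · filter_upwards [self_mem_nhdsWithin] with x hx using norm_smul_resolv_le hρ hx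
  · rintro _ ⟨y, rfl⟩
    have h0 : Tendsto (fun x : ℝ => x * (2 * ‖y‖)) (𝓝[>] 0) (𝓝 0) := by
      have : Continuous fun x : ℝ => x * (2 * ‖y‖) := by fun_prop
      simpa using (this.tendsto 0).mono_left nhdsWithin_le_nhds
    refine squeeze_zero_norm' ?_ h0
    filter_upwards [self_mem_nhdsWithin] with x hx
    have h1 : ((x : ℂ) • resolv ρ x) (ρ y) = (x : ℂ) • (y - ((x : ℂ) • resolv ρ x) y) := by
      have := congrArg (fun T : H →L[ℂ] H => (x : ℂ) • T y) (resolv_mul hρ hx)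
      exact this
    rw [h1, norm_smul, Complex.norm_real, Real.norm_of_nonneg (le_of_lt hx)]
    refine mul_le_mul_of_nonneg_left ?_ (le_of_lt hx)
    have h2 := ContinuousLinearMap.le_of_opNorm_le _ (norm_smul_resolv_le hρ hx) y
    have h3 := norm_sub_le y (((x : ℂ) • resolv ρ x) y)
    linarith

theorem tendsto_smul_resolv_atTop (hρ : 0 ≤ ρ) (w : H) :
    Tendsto (fun x : ℝ => ((x : ℂ) • resolv ρ x) w) atTop (𝓝 w) := by
  rw [tendsto_iff_norm_sub_tendsto_zero]
  have h0 : Tendsto (fun x : ℝ => ‖ρ‖ * x⁻¹ * ‖w‖) atTop (𝓝 0) := by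
    simpa using (tendsto_inv_atTop_zero.const_mul ‖ρ‖).mul_const ‖w‖
  refine squeeze_zero' (.of_forall fun _ => norm_nonneg _) ?_ h0
  filter_upwards [eventually_gt_atTop 0] with x hx
  have h1 : ((x : ℂ) • resolv ρ x) w - w = -((ρ * resolv ρ x) w) := by
    rw [mul_resolv hρ hx]
    exact (neg_sub w _).symm
  rw [h1, norm_neg]
  refine ContinuousLinearMap.le_of_opNorm_le _ ((norm_mul_le _ _).trans ?_) w
  gcongr
  exact norm_resolv_le hρ hx

/-- Operator version of d/dx [x/(l+x)] = l/(l+x)². -/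
theorem hasDerivAt_re_inner_smul_resolv (hρ : 0 ≤ ρ) (hx : 0 < x) (w : H) :
    HasDerivAt (fun x : ℝ => (⟪w, ((x : ℂ) • resolv ρ x) w⟫_ℂ).re)
      (‖resolv ρ x (CFC.sqrt ρ w)‖ ^ 2) x := by
  rw [norm_apply_sqrt_sq hρ (isSelfAdjoint_resolv hρ hx) (commute_resolv_sqrt hρ hx)]
  have h1 : HasDerivAt (fun x : ℝ => (x : ℂ) • resolv ρ x) (ρ * (resolv ρ x * resolv ρ x)) x := by
    refine (((hasDerivAt_id x).ofReal_comp).smul (hasDerivAt_resolv hρ hx)).congr_deriv ?_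
    rw [← mul_assoc, mul_resolv hρ hx, sub_mul, one_mul]
    simp
    abel
  let Λ : (H →L[ℂ] H) →L[ℝ] ℝ :=
    Complex.reCLM.comp (((innerSL ℂ w).comp (ContinuousLinearMap.apply ℂ H w)).restrictScalars ℝ)
  exact Λ.hasFDerivAt.comp_hasDerivAt x h1

theorem integrableOn_norm_resolv_sqrt_sq (hρ : 0 ≤ ρ)
    (hker : LinearMap.ker (ρ : H →ₗ[ℂ] H) = ⊥) (w : H) :
    IntegrableOn (fun x => ‖resolv ρ x (CFC.sqrt ρ w)‖ ^ 2) (Set.Ioi 0) ∧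
      ∫ x in Set.Ioi (0 : ℝ), ‖resolv ρ x (CFC.sqrt ρ w)‖ ^ 2 = ‖w‖ ^ 2 := by
  set g : ℝ → ℝ := fun x => (⟪w, ((x : ℂ) • resolv ρ x) w⟫_ℂ).re with hg
  -- At x = 0 the value of `resolv` may be the default of `Ring.inverse`; the factor x makes g(0) =
  -- 0 regardless, which agrees with the limit from the right.
  have hg0 : g 0 = 0 := by simp [hg]
  have hlim : ∀ {l : Filter ℝ} {v : H}, Tendsto (fun x : ℝ => ((x : ℂ) • resolv ρ x) w) l (𝓝 v) →
      Tendsto g l (𝓝 (⟪w, v⟫_ℂ).re) := fun h =>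
    (Complex.continuous_re.tendsto _).comp ((tendsto_const_nhds (x := w)).inner (𝕜 := ℂ) h)
  have hc : ContinuousWithinAt g (Set.Ici 0) 0 := by
    rw [← continuousWithinAt_Ioi_iff_Ici, ContinuousWithinAt, hg0]
    simpa using hlim (tendsto_smul_resolv_zero hρ hker w)
  have htop : Tendsto g atTop (𝓝 (‖w‖ ^ 2)) := by
    have h := hlim (tendsto_smul_resolv_atTop hρ w)
    rwa [← RCLike.re_to_complex, inner_self_eq_norm_sq] at h
  have hd : ∀ x ∈ Set.Ioi (0 : ℝ), HasDerivAt g (‖resolv ρ x (CFC.sqrt ρ w)‖ ^ 2) x :=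
    fun x hx => hasDerivAt_re_inner_smul_resolv hρ hx w
  refine ⟨integrableOn_Ioi_deriv_of_nonneg hc hd (fun _ _ => sq_nonneg _) htop, ?_⟩
  rw [integral_Ioi_of_hasDerivAt_of_nonneg hc hd (fun _ _ => sq_nonneg _) htop, hg0, sub_zero]

end Resolvent

/-! ### The semigroup generated by `-ρ / 2` -/

section Semigroup

theorem neg_smul_eq_smul_neg (ρ : H →L[ℂ] H) (t : ℝ) : -((t : ℝ) : ℂ) • ρ = t • (-ρ) := by
  rw [neg_smul, smul_neg, Complex.coe_smul]

theorem expSemigroup_eq (ρ : H →L[ℂ] H) (s : ℝ) :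
    expSemigroup ρ s = NormedSpace.exp ((s / 2) • (-ρ)) := by
  rw [expSemigroup, neg_smul_eq_smul_neg]

theorem exp_smul_neg_eq_cfc (hρ : IsSelfAdjoint ρ) (t : ℝ) :
    NormedSpace.exp (t • (-ρ)) = cfc (fun l : ℝ => Real.exp (-t * l)) ρ := by
  have h1 : t • (-ρ) = cfc (fun l : ℝ => -t * l) ρ := by
    rw [cfc_const_mul_id (-t) ρ, neg_smul, smul_neg]
  have h2 : IsSelfAdjoint (t • (-ρ)) := h1 ▸ cfc_predicate _ ρ
  rw [← CFC.real_exp_eq_normedSpace_exp h2, h1, ← cfc_comp' Real.exp (fun l : ℝ => -t * l) ρ]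

theorem isSelfAdjoint_exp_smul_neg (hρ : IsSelfAdjoint ρ) (t : ℝ) :
    IsSelfAdjoint (NormedSpace.exp (t • (-ρ))) := by
  rw [exp_smul_neg_eq_cfc hρ]
  exact cfc_predicate _ ρ

theorem norm_exp_smul_neg_le (hρ : 0 ≤ ρ) {t : ℝ} (ht : 0 ≤ t) :
    ‖NormedSpace.exp (t • (-ρ))‖ ≤ 1 := by
  rw [exp_smul_neg_eq_cfc (.of_nonneg hρ)]
  refine norm_cfc_le zero_le_one fun l hl => ?_
  rw [Real.norm_eq_abs, Real.abs_exp, Real.exp_le_one_iff, neg_mul, neg_nonpos]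
  exact mul_nonneg ht (spectrum_real_nonneg hρ hl)

/-- From t l ≤ e^{tl}. This gives decay of e^{-tρ} on the dense range of ρ, and hence strong
convergence to 0. -/
theorem norm_exp_smul_neg_mul_le (hρ : 0 ≤ ρ) {t : ℝ} (ht : 0 < t) :
    ‖NormedSpace.exp (t • (-ρ)) * ρ‖ ≤ t⁻¹ := by
  have hs : IsSelfAdjoint ρ := .of_nonneg hρ
  have h1 : NormedSpace.exp (t • (-ρ)) * ρ = cfc (fun l : ℝ => Real.exp (-t * l) * l) ρ := by
    rw [cfc_mul (fun l : ℝ => Real.exp (-t * l)) (fun l => l) ρ, cfc_id' ℝ ρ,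
      exp_smul_neg_eq_cfc hs]
  rw [h1]
  refine norm_cfc_le (inv_nonneg.mpr ht.le) fun l hl => ?_
  have hl := spectrum_real_nonneg hρ hl
  rw [Real.norm_of_nonneg (by positivity), neg_mul, Real.exp_neg, inv_mul_le_iff₀ (Real.exp_pos _),
    ← div_eq_mul_inv, le_div_iff₀ ht]
  linarith [Real.add_one_le_exp (t * l), mul_comm t l]

theorem tendsto_exp_smul_neg_atTop (hρ : 0 ≤ ρ) (hker : LinearMap.ker (ρ : H →ₗ[ℂ] H) = ⊥)
    (w : H) : Tendsto (fun t : ℝ => NormedSpace.exp (t • (-ρ)) w) atTop (𝓝 0) := by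
  refine tendsto_apply_zero_of_dense (dense_range_of_isSelfAdjoint (.of_nonneg hρ) hker) ?_ ?_ w
  · filter_upwards [eventually_ge_atTop 0] with t ht using norm_exp_smul_neg_le hρ ht
  · rintro _ ⟨y, rfl⟩
    have h0 : Tendsto (fun t : ℝ => t⁻¹ * ‖y‖) atTop (𝓝 0) := by
      simpa using tendsto_inv_atTop_zero.mul_const ‖y‖
    refine squeeze_zero_norm' ?_ h0
    filter_upwards [eventually_gt_atTop 0] with t ht
    exact ContinuousLinearMap.le_of_opNorm_le _ (norm_exp_smul_neg_mul_le hρ ht) y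

theorem continuous_expSemigroup (ρ : H →L[ℂ] H) : Continuous (expSemigroup ρ) := by
  have h : Continuous fun t : ℝ => NormedSpace.exp (t • (-ρ)) :=
    continuous_iff_continuousAt.mpr fun t =>
      (hasDerivAt_exp_smul_const (𝕂 := ℝ) (-ρ) t).continuousAt
  have := h.comp (continuous_id.div_const (2 : ℝ))
  simpa only [Function.comp_def, id_eq, ← expSemigroup_eq] using this

theorem expSemigroup_mul_self (ρ : H →L[ℂ] H) (s : ℝ) :
    expSemigroup ρ s * expSemigroup ρ s = NormedSpace.exp (s • (-ρ)) := by
  let _ : NormedAlgebra ℚ (H →L[ℂ] H) := NormedAlgebra.restrictScalars ℚ ℂ _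
  rw [expSemigroup_eq, ← NormedSpace.exp_add_of_commute (Commute.refl _), ← add_smul, add_halves]

/-- Operator version of d/ds [-e^{-sl}] = l e^{-sl}; the halves in the two semigroup factors add up.
-/
theorem hasDerivAt_neg_re_inner_exp (hρ : 0 ≤ ρ) (s : ℝ) (w : H) :
    HasDerivAt (fun s : ℝ => -(⟪w, NormedSpace.exp (s • (-ρ)) w⟫_ℂ).re)
      (‖expSemigroup ρ s (CFC.sqrt ρ w)‖ ^ 2) s := by
  have hs : IsSelfAdjoint ρ := .of_nonneg hρ
  have hsa : IsSelfAdjoint (expSemigroup ρ s) := by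
    rw [expSemigroup_eq]
    exact isSelfAdjoint_exp_smul_neg hs _
  have hc : Commute (expSemigroup ρ s) (CFC.sqrt ρ) := by
    rw [expSemigroup_eq]
    exact ((commute_sqrt hρ).neg_left.smul_left _).exp_left
  rw [norm_apply_sqrt_sq hρ hsa hc, expSemigroup_mul_self]
  let Λ : (H →L[ℂ] H) →L[ℝ] ℝ :=
    Complex.reCLM.comp (((innerSL ℂ w).comp (ContinuousLinearMap.apply ℂ H w)).restrictScalars ℝ)
  have h := (Λ.hasFDerivAt.comp_hasDerivAt s (hasDerivAt_exp_smul_const' (𝕂 := ℝ) (-ρ) s)).neg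
  rw [neg_mul, map_neg, neg_neg] at h
  exact h

theorem integrableOn_norm_expSemigroup_sqrt_sq (hρ : 0 ≤ ρ)
    (hker : LinearMap.ker (ρ : H →ₗ[ℂ] H) = ⊥) (w : H) :
    IntegrableOn (fun s => ‖expSemigroup ρ s (CFC.sqrt ρ w)‖ ^ 2) (Set.Ioi 0) ∧
      ∫ s in Set.Ioi (0 : ℝ), ‖expSemigroup ρ s (CFC.sqrt ρ w)‖ ^ 2 = ‖w‖ ^ 2 := by
  have hd : ∀ s ∈ Set.Ici (0 : ℝ), HasDerivAt _ (‖expSemigroup ρ s (CFC.sqrt ρ w)‖ ^ 2) s :=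
    fun s _ => hasDerivAt_neg_re_inner_exp hρ s w
  have htop : Tendsto (fun s : ℝ => -(⟪w, NormedSpace.exp (s • (-ρ)) w⟫_ℂ).re) atTop (𝓝 0) := by
    have h := ((Complex.continuous_re.tendsto _).comp ((tendsto_const_nhds (x := w)).inner (𝕜 := ℂ)
      (tendsto_exp_smul_neg_atTop hρ hker w))).neg
    simpa only [inner_zero_right, Complex.zero_re, neg_zero, Function.comp_def] using h
  refine ⟨integrableOn_Ioi_deriv_of_nonneg' hd (fun _ _ => sq_nonneg _) htop, ?_⟩
  rw [integral_Ioi_of_hasDerivAt_of_nonneg' hd (fun _ _ => sq_nonneg _) htop, zero_smul,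
    NormedSpace.exp_zero, one_apply_eq_self, zero_sub, neg_neg, ← RCLike.re_to_complex,
    inner_self_eq_norm_sq]

end Semigroup

/-! ### Assembly of the four forms -/

variable {J A ρ' : H →L[ℂ] H}

/-- A form `⟨J⁻¹ u, A J⁻¹ v⟩` with `A ≥ 1` bounded is closed and semibounded, and it defines a
self-adjoint operator. -/
theorem closed_semibounded_definesLD_of_eq_inner (hJ : IsSelfAdjoint J)
    (hker : LinearMap.ker (J : H →ₗ[ℂ] H) = ⊥) (hA : IsSelfAdjoint A)
    (hco : ∀ w, ‖w‖ ^ 2 ≤ (⟪w, A w⟫_ℂ).re)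
    {F : (unboundedInv J).domain → (unboundedInv J).domain → ℂ}
    (hF : ∀ u v, F u v = ⟪unboundedInv J u, A (unboundedInv J v)⟫_ℂ) :
    IsSemiboundedForm (unboundedInv J).domain F ∧ IsClosedForm (unboundedInv J).domain F ∧
      DefinesLD ρ' (unboundedInv J).domain F :=
  ⟨isSemiboundedForm_of_eq_inner (dense_unboundedInv_domain hJ hker) (unboundedInv J).toFun
    (isPositive_of_re_inner_nonneg hA fun w => (sq_nonneg _).trans (hco w)) hF,
    isClosedForm_of_eq_inner_unboundedInv hker hco hF,
    definesLD_of_eq_inner_unboundedInv ρ' hJ hker hA hco hF⟩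

/-- A form `∫ ⟨T x u, S T x v⟩ dx` with `S ≥ 1` bounded and `∫ ‖T x J w‖² dx = ‖w‖²` converges, is
closed and semibounded, and defines a self-adjoint operator. -/
theorem closed_semibounded_definesLD_of_integral (hJ : IsSelfAdjoint J)
    (hker : LinearMap.ker (J : H →ₗ[ℂ] H) = ⊥) {S : H →L[ℂ] H} (hS : IsSelfAdjoint S)
    (hco : ∀ w, ‖w‖ ^ 2 ≤ (⟪w, S w⟫_ℂ).re) {T : ℝ → H →L[ℂ] H}
    (hT : ContinuousOn T (Set.Ioi 0))
    (hi : ∀ w, IntegrableOn (fun x => ‖T x (J w)‖ ^ 2) (Set.Ioi 0) ∧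
      ∫ x in Set.Ioi (0 : ℝ), ‖T x (J w)‖ ^ 2 = ‖w‖ ^ 2)
    {F : (unboundedInv J).domain → (unboundedInv J).domain → ℂ}
    (hF : ∀ u v, F u v = ∫ x in Set.Ioi (0 : ℝ), ⟪T x u, S (T x v)⟫_ℂ) :
    (∀ u v : (unboundedInv J).domain,
      IntegrableOn (fun x => ⟪T x u, S (T x v)⟫_ℂ) (Set.Ioi 0)) ∧
    IsSemiboundedForm (unboundedInv J).domain F ∧ IsClosedForm (unboundedInv J).domain F ∧
      DefinesLD ρ' (unboundedInv J).domain F := by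
  have hm : ∀ w, AEStronglyMeasurable (fun x => (T x * J) w) (volume.restrict (Set.Ioi 0)) :=
    fun w => (hT.clm_apply continuousOn_const).aestronglyMeasurable measurableSet_Ioi
  have hi' : ∀ w, IntegrableOn (fun x => ‖(T x * J) w‖ ^ 2) (Set.Ioi 0) := fun w => (hi w).1
  -- The isometry identity is used in both directions: ≤ gives boundedness with C = 1, and ≥ gives A
  -- ≥ 1 below.
  obtain ⟨A, hA, hAco, hAF⟩ := exists_average (C := 1) hm hi'
    (fun w => (hi w).2.le.trans_eq (one_mul _).symm) hS hco
  refine ⟨fun u v => ?_, closed_semibounded_definesLD_of_eq_inner hJ hker hA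
    (fun w => (hi w).2.ge.trans (hAco w)) fun u v => ?_⟩
  · have := integrable_inner_average (S := S) hm hi' (unboundedInv J u) (unboundedInv J v)
    simp only [mul_apply_eq_comp, apply_unboundedInv hker] at this
    exact this
  · rw [← hAF, hF]
    simp only [mul_apply_eq_comp, apply_unboundedInv hker]

/-- The form with the semigroup generated by `ρ⁻¹` is given by a bounded positive operator. -/
theorem exists_isPositive_formTilde (hρ : 0 ≤ ρ) (hρ' : IsSelfAdjoint ρ') :
    (∀ u v : H, IntegrableOn (integrandTilde ρ ρ' u v) (Set.Ioi 0)) ∧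
    ∃ A : H →L[ℂ] H, A.IsPositive ∧
      ∀ u v : H, ∫ s in Set.Ioi (0 : ℝ), integrandTilde ρ ρ' u v s = ⟪u, A v⟫_ℂ := by
  have hm := aestronglyMeasurable_expInvSemigroup_apply hρ
  have hi := integrableOn_norm_expInvSemigroup_sq hρ
  refine ⟨fun u v => integrable_inner_average hm hi u v, ?_⟩
  obtain ⟨A, hA, hAco, hAF⟩ := exists_average hm hi (integral_norm_expInvSemigroup_sq_le hρ)
    (isSelfAdjoint_shifted hρ') (norm_sq_le_re_inner_shifted ρ')
  exact ⟨A, isPositive_of_re_inner_nonneg hA fun w =>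
    (integral_nonneg fun _ => sq_nonneg _).trans (hAco w), hAF⟩

end QuantumLD

theorem theorem5p1 {H : Type*} [NormedAddCommGroup H] [InnerProductSpace ℂ H] [CompleteSpace H]
    [TopologicalSpace.SeparableSpace H]
    (I : Set ℝ) (hI : I.OrdConnected) (hI' : I.Nontrivial)
    (ρ ρ' : ℝ → H →L[ℂ] H)
    (hstate : ∀ θ ∈ I, QuantumLD.IsState (ρ θ))
    (hker : ∀ θ ∈ I, LinearMap.ker (ρ θ : H →ₗ[ℂ] H) = ⊥)
    (hderiv : ∀ θ ∈ I, QuantumLD.HasWeakStarDerivWithinAt ρ (ρ' θ) I θ)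
    (θ : ℝ) (hθ : θ ∈ I) :
    -- the resolvent form on the domain of `ρ^{-1/2}`
    ((∀ u v : (QuantumLD.rhoInvSqrt (ρ θ)).domain,
        MeasureTheory.IntegrableOn (QuantumLD.integrandBvN (ρ θ) (ρ' θ) u v) (Set.Ioi 0)) ∧
      QuantumLD.IsSemiboundedForm (QuantumLD.rhoInvSqrt (ρ θ)).domain
        (QuantumLD.formBvN (ρ θ) (ρ' θ) (QuantumLD.rhoInvSqrt (ρ θ)).domain) ∧
      QuantumLD.IsClosedForm (QuantumLD.rhoInvSqrt (ρ θ)).domain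
        (QuantumLD.formBvN (ρ θ) (ρ' θ) (QuantumLD.rhoInvSqrt (ρ θ)).domain) ∧
      QuantumLD.DefinesLD (ρ' θ) (QuantumLD.rhoInvSqrt (ρ θ)).domain
        (QuantumLD.formBvN (ρ θ) (ρ' θ) (QuantumLD.rhoInvSqrt (ρ θ)).domain)) ∧
    -- the form with `exp (-s / (2 ρ))` on the domain of `ρ⁻¹`, and its closure on all of `H`
    ((∀ u v : H,
        MeasureTheory.IntegrableOn (QuantumLD.integrandTilde (ρ θ) (ρ' θ) u v) (Set.Ioi 0)) ∧
      QuantumLD.IsSemiboundedForm (QuantumLD.rhoInv (ρ θ)).domain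
        (QuantumLD.formTilde (ρ θ) (ρ' θ) (QuantumLD.rhoInv (ρ θ)).domain) ∧
      QuantumLD.IsFormClosure (QuantumLD.rhoInv (ρ θ)).domain
        (QuantumLD.formTilde (ρ θ) (ρ' θ) (QuantumLD.rhoInv (ρ θ)).domain)
        ⊤ (QuantumLD.formTilde (ρ θ) (ρ' θ) ⊤) ∧
      QuantumLD.DefinesLD (ρ' θ) ⊤ (QuantumLD.formTilde (ρ θ) (ρ' θ) ⊤) ∧
      ∃! K : H →ₗ.[ℂ] H, IsSelfAdjoint K ∧
        ∃ hD : (QuantumLD.rhoInv (ρ θ)).domain ≤ K.domain,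
          ∀ u v : (QuantumLD.rhoInv (ρ θ)).domain,
            QuantumLD.formTilde (ρ θ) (ρ' θ) (QuantumLD.rhoInv (ρ θ)).domain u v =
              inner ℂ (u : H) (K (Submodule.inclusion hD v))) ∧
    -- the form with `ρ^{-1/2}` on the domain of `ρ^{-1/2}`
    (QuantumLD.IsSemiboundedForm (QuantumLD.rhoInvSqrt (ρ θ)).domain
        (QuantumLD.formHat (ρ θ) (ρ' θ)) ∧
      QuantumLD.IsClosedForm (QuantumLD.rhoInvSqrt (ρ θ)).domain
        (QuantumLD.formHat (ρ θ) (ρ' θ)) ∧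
      QuantumLD.DefinesLD (ρ' θ) (QuantumLD.rhoInvSqrt (ρ θ)).domain
        (QuantumLD.formHat (ρ θ) (ρ' θ))) ∧
    -- the form with `exp (-s ρ / 2)` on the domain of `ρ^{-1/2}`
    ((∀ u v : (QuantumLD.rhoInvSqrt (ρ θ)).domain,
        MeasureTheory.IntegrableOn (QuantumLD.integrandSLD (ρ θ) (ρ' θ) u v) (Set.Ioi 0)) ∧
      QuantumLD.IsSemiboundedForm (QuantumLD.rhoInvSqrt (ρ θ)).domain
        (QuantumLD.formSLD (ρ θ) (ρ' θ) (QuantumLD.rhoInvSqrt (ρ θ)).domain) ∧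
      QuantumLD.IsClosedForm (QuantumLD.rhoInvSqrt (ρ θ)).domain
        (QuantumLD.formSLD (ρ θ) (ρ' θ) (QuantumLD.rhoInvSqrt (ρ θ)).domain) ∧
      QuantumLD.DefinesLD (ρ' θ) (QuantumLD.rhoInvSqrt (ρ θ)).domain
        (QuantumLD.formSLD (ρ θ) (ρ' θ) (QuantumLD.rhoInvSqrt (ρ θ)).domain)) := by
  have hρ : 0 ≤ ρ θ := (ContinuousLinearMap.nonneg_iff_isPositive _).mpr (hstate θ hθ).isPositive
  have hρ' : IsSelfAdjoint (ρ' θ) := QuantumLD.isSelfAdjoint_of_hasWeakStarDerivWithinAt hI hI'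
    (fun t ht => (hstate t ht).isPositive.isSelfAdjoint) hθ (hderiv θ hθ)
  have hS := QuantumLD.isSelfAdjoint_shifted hρ'
  have hco := QuantumLD.norm_sq_le_re_inner_shifted (ρ' θ)
  have hJ := QuantumLD.isSelfAdjoint_sqrt (ρ θ)
  have hJker := QuantumLD.ker_sqrt_eq_bot hρ (hker θ hθ)
  have hD := QuantumLD.dense_unboundedInv_domain (.of_nonneg hρ) (hker θ hθ)
  obtain ⟨hint, A, hA, hAF⟩ := QuantumLD.exists_isPositive_formTilde hρ hρ'
  refine ⟨QuantumLD.closed_semibounded_definesLD_of_integral hJ hJker hS hco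
      (QuantumLD.continuousOn_resolv hρ)
      (QuantumLD.integrableOn_norm_resolv_sqrt_sq hρ (hker θ hθ)) fun _ _ => rfl,
    ⟨hint, QuantumLD.isSemiboundedForm_of_eq_inner hD (Submodule.subtype _) hA
        fun u v => hAF u v,
      QuantumLD.isFormClosure_top hA hD (fun u v => hAF u v) fun u v => hAF u v,
      QuantumLD.definesLD_top _ hA.isSelfAdjoint fun u v => hAF u v,
      QuantumLD.existsUnique_isSelfAdjoint_of_bounded hA.isSelfAdjoint hD fun u v => hAF u v⟩,
    QuantumLD.closed_semibounded_definesLD_of_eq_inner hJ hJker hS hco fun _ _ => rfl,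
    QuantumLD.closed_semibounded_definesLD_of_integral hJ hJker hS hco
      (QuantumLD.continuous_expSemigroup (ρ θ)).continuousOn
      (QuantumLD.integrableOn_norm_expSemigroup_sqrt_sq hρ (hker θ hθ)) fun _ _ => rfl⟩
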